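/- Let $\Delta\in\mathbb{N}$ and let $c\ge 1$ be a real constant. There is no deterministic algorithm of complexity $o(\log n)$ in the LOCAL model that produces a vertex coloring with $\Delta$ colors on the class of finite acyclic graphs of maximum degree at most $\Delta$. Here a deterministic algorithm of complexity $(t_n)_{n}\in\mathbb{R}^{\mathbb{N}}$ is a sequence $(\mathcal{A}_n)_n$ of arbitrary functions, where $\mathcal{A}_n$ assigns a color to every isomorphism class of rooted graphs labeled by natural numbers. Given a graph $G$ with $n$ vertices and identifiers $\mathrm{id}$, that is, an injective map from $V(G)$ to the natural numbers less than $n^c$, it outputs at each vertex $v$ the color $\mathcal{A}_n(B_G(v,t_n))$, where $B_G(v,t_n)$ is the subgraph of $G$ induced on the vertices at distance at most $t_n$ from $v$, rooted at $v$ and labeled by the restriction of $\mathrm{id}$ (the radius is read as $0$ if $t_n<0$). The algorithm produces a vertex coloring with $k$ colors on a class of finite graphs if for every graph $G$ in the class and every assignment $\mathrm{id}$ of identifiers, the output takes values in $\{1,\dots,k\}$ and is different at adjacent vertices. So the claim is that there is no sequence with $\lim_{n\to\infty} t_n/\log n=0$ for which a deterministic algorithm of complexity $(t_n)_n$ produces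 a vertex coloring with $\Delta$ colors on this class. -/

import Mathlib

open Filter Asymptotics

namespace LocalModel

/-- A graph with a distinguished root, whose vertices are labeled by natural numbers. -/
structure RootedLabeledGraph where
  V : Type
  graph : SimpleGraph V
  root : V
  label : V → ℕ

/-- Isomorphism of rooted labeled graphs: a graph isomorphism that respects roots and labels. -/
def RootedLabeledGraph.Isomorphic (B B' : RootedLabeledGraph) : Prop :=
  ∃ φ : B.graph ≃g B'.graph, φ B.root = B'.root ∧ ∀ x, B'.label (φ x) = B.label x

/-- The set of vertices of `G` at graph distance at most `r` from `v` (vertices in other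
components are at infinite distance). -/
def ballSet {V : Type} (G : SimpleGraph V) (v : V) (r : ℕ) : Set V :=
  {w | ∃ p : G.Walk v w, p.length ≤ r}

theorem mem_ballSet_self {V : Type} (G : SimpleGraph V) (v : V) (r : ℕ) : v ∈ ballSet G v r :=
  ⟨SimpleGraph.Walk.nil, Nat.zero_le r⟩

/-- The `r`-neighborhood of `v` in `G`: the subgraph of `G` induced on the vertices at distance
at most `r` from `v`, rooted at `v`, together with the restriction of the labeling `ids`. -/
def ball {V : Type} (G : SimpleGraph V) (ids : V → ℕ) (v : V) (r : ℕ) : RootedLabeledGraph where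
  V := ballSet G v r
  graph := G.induce (ballSet G v r)
  root := ⟨v, mem_ballSet_self G v r⟩
  label := fun w => ids w

/-- A deterministic distributed algorithm: a sequence `(𝒜 n)` of arbitrary functions (one for each
size `n` of the network), assigning to every rooted labeled graph a color that depends only on its
isomorphism class. -/
structure DetAlgorithm where
  run : ℕ → RootedLabeledGraph → ℕ
  run_eq_of_isomorphic : ∀ (n : ℕ) (B B' : RootedLabeledGraph),
    B.Isomorphic B' → run n B = run n B'

/-- The output at `v` of the algorithm `𝒜` with complexity `t`, when it is applied to the graph `G`
with identifiers `ids`. Distances are integers, so the `t n`-neighborhood is the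
`⌊t n⌋₊`-neighborhood. -/
noncomputable def DetAlgorithm.output (𝒜 : DetAlgorithm) (t : ℕ → ℝ) {V : Type} [Fintype V]
    (G : SimpleGraph V) (ids : V → ℕ) (v : V) : ℕ :=
  𝒜.run (Fintype.card V) (ball G ids v ⌊t (Fintype.card V)⌋₊)

/-- `ids` is an assignment of unique identifiers from the range `{0, 1, …} ∩ [0, n ^ c)`, where
`n` is the number of vertices. -/
def IsIdAssignment (c : ℝ) {V : Type} [Fintype V] (ids : V → ℕ) : Prop :=
  Function.Injective ids ∧ ∀ v, (ids v : ℝ) < (Fintype.card V : ℝ) ^ c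

/-- `f` is a vertex coloring of `G` with the `k` colors `1, …, k`. -/
def IsVertexColoring {V : Type} (G : SimpleGraph V) (k : ℕ) (f : V → ℕ) : Prop :=
  (∀ v, 1 ≤ f v ∧ f v ≤ k) ∧ ∀ v w, G.Adj v w → f v ≠ f w

/-- A class of finite graphs. -/
abbrev GraphClass := ∀ (V : Type) [Fintype V], SimpleGraph V → Prop

/-- On the class `𝒞`, with identifiers from a range of size `n ^ c`, there is a deterministic
distributed algorithm of complexity `t` that produces a vertex coloring with `k` colors. -/
def HasDetColoringAlgorithm (𝒞 : GraphClass) (c : ℝ) (k : ℕ) (t : ℕ → ℝ) : Prop :=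
  ∃ 𝒜 : DetAlgorithm, ∀ (V : Type) [Fintype V] (G : SimpleGraph V), 𝒞 V G →
    ∀ ids : V → ℕ, IsIdAssignment c ids → IsVertexColoring G k (𝒜.output t G ids)

/-- The class of finite acyclic graphs (forests) of degree at most `Δ`. -/
def acyclicOfDegreeLE (Δ : ℕ) : GraphClass := fun _ _ G =>
  G.IsAcyclic ∧ ∀ v, (G.neighborSet v).ncard ≤ Δ

end LocalModel

/-! The proof is round elimination relative to an auxiliary graph on the identifiers. Put `r = ⌊t
n⌋₊`, and let `H` be a graph on the identifiers `0, …, n - 1` with edges colored by `Δ` colors and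
girth above `2 * (r + 1)`. The `Δ`-regular tree with properly colored edges is labeled only by
color-preserving homomorphisms to `H` (`Legal`). By the girth condition such a labeling is injective
on the ball of radius `r + 1`, so the image of this ball, with the unused identifiers as isolated
vertices, is a forest on `n` vertices on which the algorithm must succeed. In particular, no tree
edge of color `i` gets the output `i` at both ends.

This weak property survives the removal of one round: labels on the two sides of an edge can be
changed independently, because legality only constrains adjacent labels. After all rounds are
removed, `exists_coloring_of_isLocal` leaves a map from identifiers to colors such that no edge of
`H` has its color at both ends; `exists_coloring_of_algorithm` combines this with the embedding of
the tree.

On the other hand, `exists_highGirth_edges` yields `H` of girth of order `log n` admitting no such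
map, by a greedy choice of edges. Since `r = o(log n)`, this girth suffices for some `n`. -/

namespace LocalModel

/-! ### The edge-colored regular tree and its edge-reversing automorphisms -/

section Words

variable {D S : Type*}

/-- Words without two equal consecutive letters: the vertices of the regular tree whose edges are
properly colored by `D`, where a word is the sequence of colors on the path from the root. -/
abbrev Reduced (w : List D) : Prop := w.IsChain (· ≠ ·)

/-- Adjacency in the tree of reduced words. -/
def TreeAdj (u v : List D) : Prop := ∃ j, v = u ++ [j] ∨ u = v ++ [j]

theorem TreeAdj.symm {u v : List D} (h : TreeAdj u v) : TreeAdj v u := by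
  obtain ⟨j, h | h⟩ := h
  exacts [⟨j, .inr h⟩, ⟨j, .inl h⟩]

theorem TreeAdj.length_le {u v : List D} (h : TreeAdj u v) : v.length ≤ u.length + 1 := by
  obtain ⟨j, rfl | rfl⟩ := h <;> grind

theorem Reduced.of_append_left {u v : List D} (h : Reduced (u ++ v)) : Reduced u :=
  (List.isChain_append.1 h).1

variable [DecidableEq D]

/-- Left multiplication of a reduced word by a letter, seen as an involution. -/
def leftMul (i : D) : List D → List D
  | [] => [i]
  | j :: w => if j = i then w else i :: j :: w

theorem Reduced.leftMul {w : List D} (h : Reduced w) (i : D) : Reduced (leftMul i w) := by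
  rcases w with _ | ⟨j, w⟩
  · simp [LocalModel.leftMul]
  · by_cases hj : j = i
    · simpa [LocalModel.leftMul, hj] using h.tail
    · simpa [LocalModel.leftMul, hj, List.isChain_cons_cons, Ne.symm hj] using h

theorem leftMul_eq_cons {i : D} {w : List D} (h : Reduced (i :: w)) : leftMul i w = i :: w := by
  rcases w with _ | ⟨j, w⟩
  · rfl
  · have : i ≠ j := (List.isChain_cons_cons.1 h).1
    simp [leftMul, this.symm]

theorem leftMul_leftMul {w : List D} (h : Reduced w) (i : D) : leftMul i (leftMul i w) = w := by
  rcases w with _ | ⟨j, w⟩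
  · simp [leftMul]
  · by_cases hj : j = i
    · subst hj
      simpa [leftMul] using leftMul_eq_cons h
    · simp [leftMul, hj]

theorem length_leftMul_le (i : D) (w : List D) : (leftMul i w).length ≤ w.length + 1 := by
  rcases w with _ | ⟨j, w⟩
  · simp [leftMul]
  · by_cases hj : j = i <;> simp [leftMul, hj]; omega

/-- Left multiplication acts on the front of a word and tree edges act on its end, so the two
commute except on the edge between the root and `[i]`, which is reversed. -/
theorem leftMul_append_singleton (i : D) (w : List D) (j : D) :
    leftMul i (w ++ [j]) = leftMul i w ++ [j] ∨
      w = [] ∧ j = i ∧ leftMul i (w ++ [j]) = [] ∧ leftMul i w = [i] := by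
  rcases w with _ | ⟨a, w⟩
  · by_cases hj : j = i <;> simp [leftMul, hj]
  · by_cases ha : a = i <;> simp [leftMul, ha]

theorem TreeAdj.leftMul {u v : List D} (h : TreeAdj u v) (i : D) :
    TreeAdj (leftMul i u) (leftMul i v) := by
  obtain ⟨j, rfl | rfl⟩ := h
  · rcases leftMul_append_singleton i u j with h | ⟨-, -, h, h'⟩
    · exact ⟨j, .inl h⟩
    · exact ⟨i, .inr (by simp [h, h'])⟩
  · rcases leftMul_append_singleton i v j with h | ⟨-, -, h, h'⟩
    · exact ⟨j, .inr h⟩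
    · exact ⟨i, .inl (by simp [h, h'])⟩

theorem treeAdj_leftMul_iff {u v : List D} (hu : Reduced u) (hv : Reduced v) (i : D) :
    TreeAdj (leftMul i u) (leftMul i v) ↔ TreeAdj u v :=
  ⟨fun h => by simpa only [leftMul_leftMul hu, leftMul_leftMul hv] using h.leftMul i,
    fun h => h.leftMul i⟩

end Words

/-! ### Round elimination -/

section RoundElimination

variable {D S : Type*} {Adj : D → S → S → Prop}

/-- A labeling of the tree that is a homomorphism to the edge-colored graph `Adj`. -/
def Legal (Adj : D → S → S → Prop) (f : List D → S) : Prop :=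
  ∀ w j, Reduced (w ++ [j]) → Adj j (f w) (f (w ++ [j]))

/-- Two labelings agree at distance at most `r` from the root. -/
def AgreeUpTo (r : ℕ) (f g : List D → S) : Prop :=
  ∀ w, Reduced w → w.length ≤ r → f w = g w

/-- The labeling that looks like `F i` in direction `i`. -/
def starGlue (x : S) (F : D → List D → S) : List D → S
  | [] => x
  | i :: w => F i (i :: w)

theorem Legal.starGlue {x : S} {F : D → List D → S} (hF : ∀ i, Legal Adj (F i))
    (hx : ∀ i, F i [] = x) : Legal Adj (starGlue x F) := by
  intro w j hw
  rcases w with _ | ⟨a, w⟩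
  · simpa [LocalModel.starGlue, hx] using hF j [] j hw
  · exact hF a (a :: w) j hw

theorem exists_legal (hserial : ∀ i x, ∃ y, Adj i x y) (x : S) :
    ∃ f : List D → S, Legal Adj f ∧ f [] = x := by
  choose next hnext using hserial
  exact ⟨fun w => w.foldl (fun y j => next j y) x, fun w j _ => by simpa using hnext _ _, rfl⟩

/-- Whatever the labels at distance `r + 1` in direction `i` are, those in the other
directions can be chosen such that the output is `i`. -/
def Forces (Adj : D → S → S → Prop) (r : ℕ) (A : (List D → S) → D) (f : List D → S) (i : D) :
    Prop :=
  ∀ g, Legal Adj g → AgreeUpTo r g f → ∃ h, Legal Adj h ∧ AgreeUpTo r h f ∧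
    (∀ w, Reduced (i :: w) → w.length ≤ r → h (i :: w) = g (i :: w)) ∧ A h = i

/-- Otherwise every direction `i` has a continuation that rules out the output `i`. All these
continuations can be imposed at once, and then no output is left. -/
theorem exists_forces {r : ℕ} (A : (List D → S) → D) (f : List D → S) :
    ∃ i, Forces Adj r A f i := by
  by_contra! hcon
  simp only [Forces, not_forall] at hcon
  choose g hg hgf hno using hcon
  have hroot : ∀ i, g i [] = f [] := fun i => hgf i [] (by simp) (by simp)
  refine hno _ ⟨starGlue (f []) g, Legal.starGlue hg hroot, ?_, fun w _ _ => rfl, rfl⟩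
  intro w hw hr
  rcases w with _ | ⟨a, w⟩
  · rfl
  · exact hgf a _ hw hr

variable [DecidableEq D]

/-- A labeling seen from the neighbor of the root in direction `i`. -/
def shift (i : D) (f : List D → S) : List D → S := fun w => f (leftMul i w)

/-- The labeling that looks like `h` on the side of the root and like `h'` on the side of its
neighbor in direction `i`. -/
def edgeGlue (i : D) (h h' : List D → S) : List D → S
  | [] => h []
  | j :: w => if j = i then h' w else h (j :: w)

theorem Legal.shift (hsymm : ∀ i x y, Adj i x y → Adj i y x) {f : List D → S} (hf : Legal Adj f)
    (i : D) : Legal Adj (shift i f) := by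
  intro w j hw
  unfold LocalModel.shift
  rcases leftMul_append_singleton i w j with h | ⟨rfl, rfl, h, h'⟩
  · rw [h]
    exact hf _ _ (h ▸ hw.leftMul i)
  · rw [h, h']
    exact hsymm _ _ _ (hf [] j (by simp))

theorem Legal.edgeGlue {i : D} {h h' : List D → S} (hh : Legal Adj h) (hh' : Legal Adj h')
    (hadj : Adj i (h []) (h' [])) : Legal Adj (edgeGlue i h h') := by
  intro w j hw
  rcases w with _ | ⟨a, w⟩
  · by_cases hj : j = i
    · subst hj
      simpa [LocalModel.edgeGlue] using hadj
    · simpa [LocalModel.edgeGlue, hj] using hh [] j hw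
  · by_cases ha : a = i
    · simpa [LocalModel.edgeGlue, ha] using hh' w j hw.tail
    · simpa [LocalModel.edgeGlue, ha] using hh (a :: w) j hw

/-- The output depends only on the labels at distance at most `r` from the root. -/
def IsLocal (Adj : D → S → S → Prop) (r : ℕ) (A : (List D → S) → D) : Prop :=
  ∀ f g, Legal Adj f → Legal Adj g → AgreeUpTo r f g → A f = A g

/-- No edge of color `i` has color `i` at both ends. -/
def IsSinkless (Adj : D → S → S → Prop) (A : (List D → S) → D) : Prop :=
  ∀ f, Legal Adj f → ∀ i, A f = i → A (shift i f) ≠ i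

/-- If both ends of an edge of color `i` force `i`, each side has a completion with output `i`
whatever lies across the edge. Gluing the two completions along the edge gives a labeling with
output `i` at both ends. -/
theorem not_forces_shift (hsymm : ∀ i x y, Adj i x y → Adj i y x) {r : ℕ}
    {A : (List D → S) → D} (hloc : IsLocal Adj (r + 1) A) (hsink : IsSinkless Adj A)
    {f : List D → S} (hf : Legal Adj f) {i : D} (h1 : Forces Adj r A f i) :
    ¬ Forces Adj r A (shift i f) i := by
  intro h2
  have hf' := hf.shift hsymm i
  obtain ⟨h, hh, hhf, hhi, hA⟩ := h1 f hf fun _ _ _ => rfl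
  obtain ⟨h', hh', hhf', hhi', hA'⟩ := h2 _ hf' fun _ _ _ => rfl
  have e1 : h [] = f [] := hhf [] (by simp) (by simp)
  have e2 : h' [] = f [i] := hhf' [] (by simp) (by simp)
  have hk : Legal Adj (edgeGlue i h h') := hh.edgeGlue hh' <| by
    rw [e1, e2]
    exact hf [] i (by simp)
  -- Across the edge, `h` copies `f` up to distance `r + 1` from the root, and there `h'` also
  -- agrees with `f`, being `r`-close to its own root. The gluing is therefore invisible from either
  -- end.
  have hk1 : AgreeUpTo (r + 1) (edgeGlue i h h') h := by
    intro w hw hr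
    rcases w with _ | ⟨a, w⟩
    · rfl
    · by_cases ha : a = i
      · subst ha
        have hr' : w.length ≤ r := by simpa using hr
        rw [hhi w hw hr']
        simp only [edgeGlue, if_true]
        rw [hhf' w hw.tail hr', shift, leftMul_eq_cons hw]
      · simp [edgeGlue, ha]
  have hk2 : AgreeUpTo (r + 1) (shift i (edgeGlue i h h')) h' := by
    intro w hw hr
    rcases w with _ | ⟨a, w⟩
    · simp [shift, leftMul, edgeGlue]
    · by_cases ha : a = i
      · subst ha
        have hr' : w.length ≤ r := by simpa using hr
        have hkw := hk1 w hw.tail (by omega)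
        simp only [shift, leftMul, if_true]
        rw [hkw, hhi' w hw hr', hhf w hw.tail hr']
        simp [shift, leftMul]
      · simp [shift, leftMul, ha, edgeGlue]
  refine hsink _ hk i ?_ ?_
  · rw [hloc _ _ hk hh hk1, hA]
  · rw [hloc _ _ (hk.shift hsymm i) hh' hk2, hA']

theorem exists_coloring_of_isLocal (hsymm : ∀ i x y, Adj i x y → Adj i y x)
    (hserial : ∀ i x, ∃ y, Adj i x y) (r : ℕ) (A : (List D → S) → D) (hloc : IsLocal Adj r A)
    (hsink : IsSinkless Adj A) : ∃ φ : S → D, ∀ i x y, Adj i x y → φ x = i → φ y ≠ i := by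
  induction r generalizing A with
  | zero =>
    choose ext hext hroot using exists_legal (Adj := Adj) hserial
    refine ⟨fun x => A (ext x), fun i x y hxy hx hy => ?_⟩
    have hk : Legal Adj (edgeGlue i (ext x) (ext y)) :=
      (hext x).edgeGlue (hext y) (by rwa [hroot, hroot])
    refine hsink _ hk i (Eq.trans (hloc _ _ hk (hext x) ?_) hx)
      (Eq.trans (hloc _ _ (hk.shift hsymm i) (hext y) ?_) hy)
    · intro w _ hw
      obtain rfl : w = [] := by simpa using hw
      rfl
    · intro w _ hw
      obtain rfl : w = [] := by simpa using hw
      simp [shift, leftMul, edgeGlue]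
  | succ r ih =>
    -- The new algorithm outputs a forced direction. The choice depends on `f` only through the
    -- predicate `Forces Adj r A f`, which sees labels up to distance `r`; this makes it local with
    -- radius `r`.
    refine ih (fun f => Classical.epsilon (h := ⟨A f⟩) (Forces Adj r A f)) ?_ ?_
    · intro f g _ _ hfg
      have : Forces Adj r A f = Forces Adj r A g := by
        have key : ∀ f' : List D → S, AgreeUpTo r f' f ↔ AgreeUpTo r f' g := fun f' =>
          ⟨fun h w hw hr => (h w hw hr).trans (hfg w hw hr),
            fun h w hw hr => (h w hw hr).trans (hfg w hw hr).symm⟩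
        funext i
        simp only [Forces, key]
      simp only [this]
    · intro f hf i h1 h2
      refine not_forces_shift hsymm hloc hsink hf (i := i) ?_ ?_
      · exact h1 ▸ Classical.epsilon_spec (exists_forces (Adj := Adj) (r := r) A f)
      · have hspec := Classical.epsilon_spec (exists_forces (Adj := Adj) (r := r) A (shift i f))
        have heq : Classical.epsilon (h := ⟨A (shift i f)⟩) (Forces Adj r A (shift i f)) = i := h2
        rwa [heq] at hspec

end RoundElimination

/-! ### Walks, girth and adding an edge -/

section Reach

variable {D S : Type*}

/-- There is a walk from `x` to `y` whose sequence of edge colors is the given word. -/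
def Reach (Adj : D → S → S → Prop) : List D → S → S → Prop
  | [], x, y => x = y
  | i :: w, x, z => ∃ y, Adj i x y ∧ Reach Adj w y z

/-- There is no closed walk of length at most `g` whose sequence of edge colors is reduced. -/
def HasGirthGT (Adj : D → S → S → Prop) (g : ℕ) : Prop :=
  ∀ w, Reduced w → w ≠ [] → w.length ≤ g → ∀ x, ¬ Reach Adj w x x

/-- Adjacency by an edge of color `i` in a set of colored edges. -/
def edgeAdj (E : Finset (D × S × S)) (i : D) (x y : S) : Prop :=
  (i, x, y) ∈ E ∨ (i, y, x) ∈ E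

theorem edgeAdj.symm {E : Finset (D × S × S)} {i : D} {x y : S} (h : edgeAdj E i x y) :
    edgeAdj E i y x := Or.symm h

variable {Adj : D → S → S → Prop}

theorem Reach.append {u v : List D} {x y z : S} (h : Reach Adj u x y) (h' : Reach Adj v y z) :
    Reach Adj (u ++ v) x z := by
  induction u generalizing x with
  | nil => obtain rfl : x = y := h; exact h'
  | cons i u ih =>
    obtain ⟨a, ha, h⟩ := h
    exact ⟨a, ha, ih h⟩

theorem Reach.reverse (hsymm : ∀ i x y, Adj i x y → Adj i y x) {u : List D} {x y : S}
    (h : Reach Adj u x y) : Reach Adj u.reverse y x := by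
  induction u generalizing x with
  | nil => exact Eq.symm h
  | cons i u ih =>
    obtain ⟨a, ha, h⟩ := h
    rw [List.reverse_cons]
    exact (ih h).append ⟨x, hsymm _ _ _ ha, rfl⟩

variable [DecidableEq D] [DecidableEq S]

/-- The walk is cut at its first use of the new edge; the remainder may use that edge again. -/
theorem Reach.of_insert {E : Finset (D × S × S)} {i : D} {x y : S} {w : List D} {a b : S}
    (h : Reach (edgeAdj (insert (i, x, y) E)) w a b) :
    Reach (edgeAdj E) w a b ∨ ∃ u v p q, w = u ++ i :: v ∧ Reach (edgeAdj E) u a p ∧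
      Reach (edgeAdj (insert (i, x, y) E)) v q b ∧ (p = x ∧ q = y ∨ p = y ∧ q = x) := by
  induction w generalizing a with
  | nil => exact .inl h
  | cons j w ih =>
    obtain ⟨c, hc, h⟩ := h
    by_cases hE : edgeAdj E j a c
    · rcases ih h with h' | ⟨u, v, p, q, rfl, hu, hv, hpq⟩
      · exact .inl ⟨c, hE, h'⟩
      · exact .inr ⟨j :: u, v, p, q, rfl, ⟨c, hE, hu⟩, hv, hpq⟩
    · right
      simp only [edgeAdj, Finset.mem_insert, Prod.mk.injEq] at hc hE
      have hc' : j = i ∧ (a = x ∧ c = y ∨ a = y ∧ c = x) := by tauto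
      obtain ⟨rfl, hac⟩ := hc'
      exact ⟨[], w, a, c, rfl, rfl, h, hac⟩

theorem HasGirthGT.insert {E : Finset (D × S × S)} {g : ℕ} (hE : HasGirthGT (edgeAdj E) g)
    {i : D} {x y : S} (hfar : ∀ w : List D, w.length ≤ g → ¬ Reach (edgeAdj E) w x y) :
    HasGirthGT (edgeAdj (insert (i, x, y) E)) g := by
  have hsymm : ∀ i x y, edgeAdj E i x y → edgeAdj E i y x := fun _ _ _ h => h.symm
  have hfar' : ∀ w : List D, w.length ≤ g → ∀ p q, (p = x ∧ q = y ∨ p = y ∧ q = x) →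
      ¬ Reach (edgeAdj E) w q p := by
    rintro w hw p q (⟨rfl, rfl⟩ | ⟨rfl, rfl⟩) h
    · exact hfar w.reverse (by simpa) (h.reverse hsymm)
    · exact hfar w hw h
  intro w hred hne hlen a h
  rcases h.of_insert with h | ⟨u, v, p, q, rfl, hu, hv, hpq⟩
  · exact hE w hred hne hlen a h
  simp only [List.length_append, List.length_cons] at hlen
  rcases hv.of_insert with hv | ⟨u', v', p', q', rfl, hu', -, hpq'⟩
  · exact hfar' (v ++ u) (by simp; omega) p q hpq (hv.append hu)
  simp only [List.length_append, List.length_cons] at hlen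
  -- The new edge is used at least twice, with `u'` between the first two uses. Same orientation
  -- makes `u'` a short connection of the ends; opposite orientation makes it a closed walk in `E`,
  -- nonempty because the color word is reduced.
  by_cases hp : p' = p
  · subst hp
    exact hfar' u' (by omega) p' q hpq hu'
  · have hp' : p' = q := by
      rcases hpq with ⟨rfl, rfl⟩ | ⟨rfl, rfl⟩ <;> rcases hpq' with ⟨rfl, rfl⟩ | ⟨rfl, rfl⟩ <;>
        simp_all
    subst hp'
    have hred' : Reduced (i :: (u' ++ i :: v')) := (List.isChain_append.1 hred).2.1
    refine hE u' ?_ ?_ (by omega) p' hu'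
    · exact (List.isChain_append.1 hred'.tail).1
    · rintro rfl
      exact (List.isChain_cons_cons.1 hred').1 rfl

/-- The edges in `E` that start at `x`. -/
def outEdges (E : Finset (D × S × S)) (x : S) : Finset (D × S × S) := E.filter (·.2.1 = x)

/-- The edges in `E` that end at `x`. -/
def inEdges (E : Finset (D × S × S)) (x : S) : Finset (D × S × S) := E.filter (·.2.2 = x)

/-- The vertices at distance at most `r` from `x`. -/
def nearSet (E : Finset (D × S × S)) : ℕ → S → Finset S
  | 0, x => {x}
  | r + 1, x => (insert x ((outEdges E x).image (·.2.2) ∪ (inEdges E x).image (·.2.1))).biUnion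
      (nearSet E r)

omit [DecidableEq D] in
theorem self_mem_nearSet (E : Finset (D × S × S)) (r : ℕ) (x : S) : x ∈ nearSet E r x := by
  induction r with
  | zero => simp [nearSet]
  | succ r ih => exact Finset.mem_biUnion.2 ⟨x, Finset.mem_insert_self _ _, ih⟩

omit [DecidableEq D] in
theorem mem_nearSet {E : Finset (D × S × S)} {r : ℕ} {w : List D} {x y : S}
    (h : Reach (edgeAdj E) w x y) (hw : w.length ≤ r) : y ∈ nearSet E r x := by
  induction w generalizing x r with
  | nil => obtain rfl : x = y := h; exact self_mem_nearSet _ _ _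
  | cons i w ih =>
    obtain ⟨z, hz, h⟩ := h
    obtain _ | r := r
    · simp at hw
    refine Finset.mem_biUnion.2 ⟨z, Finset.mem_insert_of_mem ?_, ih h (by simpa using hw)⟩
    rcases hz with hz | hz
    · exact Finset.mem_union_left _ (Finset.mem_image.2
        ⟨(i, x, z), by simpa [outEdges] using hz, rfl⟩)
    · exact Finset.mem_union_right _ (Finset.mem_image.2
        ⟨(i, z, x), by simpa [inEdges] using hz, rfl⟩)

omit [DecidableEq D] in
theorem card_nearSet_le {E : Finset (D × S × S)} {d : ℕ} (hout : ∀ x, (outEdges E x).card ≤ d)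
    (hin : ∀ x, (inEdges E x).card ≤ d) (r : ℕ) (x : S) :
    (nearSet E r x).card ≤ (2 * d + 1) ^ r := by
  induction r generalizing x with
  | zero => simp [nearSet]
  | succ r ih =>
    refine (Finset.card_biUnion_le_card_mul _ _ _ fun z _ => ih z).trans ?_
    rw [pow_succ, mul_comm]
    refine Nat.mul_le_mul_left _ ((Finset.card_insert_le _ _).trans ?_)
    have h1 := Finset.card_union_le ((outEdges E x).image (·.2.2)) ((inEdges E x).image (·.2.1))
    have h2 := Finset.card_image_le (s := outEdges E x) (f := (·.2.2))
    have h3 := Finset.card_image_le (s := inEdges E x) (f := (·.2.1))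
    have h4 := hout x
    have h5 := hin x
    omega

end Reach

/-! ### Greedy construction of the identifier graph -/

section Greedy

variable {D S : Type*} [DecidableEq D] [DecidableEq S] [Fintype D] [Fintype S]

/-- The maps `φ` such that no edge of `E` has its color at both ends. -/
def unhit (E : Finset (D × S × S)) : Finset (S → D) :=
  Finset.univ.filter fun φ => ∀ e ∈ E, ¬ (φ e.2.1 = e.1 ∧ φ e.2.2 = e.1)

-- Cauchy–Schwarz applied to the sizes of the color classes.
omit [DecidableEq S] in
theorem sq_card_le_card_mul_card_monochromatic (φ : S → D) :
    Fintype.card S ^ 2 ≤ Fintype.card D *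
      (Finset.univ.filter fun p : S × S => φ p.1 = φ p.2).card := by
  have h1 : Fintype.card S = ∑ i, (Finset.univ.filter fun x => φ x = i).card :=
    Finset.card_eq_sum_card_fiberwise (s := Finset.univ) (t := Finset.univ) (f := φ)
      fun _ _ => Finset.mem_coe.2 (Finset.mem_univ _)
  have h2 : (Finset.univ.filter fun p : S × S => φ p.1 = φ p.2).card =
      ∑ i, (Finset.univ.filter fun x => φ x = i).card ^ 2 := by
    rw [Finset.card_eq_sum_card_fiberwise (t := Finset.univ) (f := fun p : S × S => φ p.1)
      fun _ _ => Finset.mem_coe.2 (Finset.mem_univ _)]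
    refine Finset.sum_congr rfl fun i _ => ?_
    rw [sq, ← Finset.card_product]
    congr 1
    ext ⟨x, y⟩
    simp only [Finset.mem_filter, Finset.mem_univ, true_and, Finset.mem_product]
    constructor
    · rintro ⟨h, rfl⟩; exact ⟨rfl, h.symm⟩
    · rintro ⟨rfl, h⟩; exact ⟨h.symm, rfl⟩
  rw [h1, h2]
  exact sq_sum_le_card_mul_sum_sq

/-- The pairs whose connection by an edge keeps the girth above `g` and the out- and in-degrees
at most `d`. -/
def freePairs (E : Finset (D × S × S)) (g d : ℕ) : Finset (S × S) :=
  Finset.univ.filter fun p =>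
    p.2 ∉ nearSet E g p.1 ∧ (outEdges E p.1).card < d ∧ (inEdges E p.2).card < d

omit [DecidableEq D] [Fintype D] in
theorem card_saturated_mul_le (E : Finset (D × S × S)) (d : ℕ) (f : D × S × S → S) :
    (Finset.univ.filter fun x => d ≤ (E.filter (f · = x)).card).card * d ≤ E.card := by
  rw [Finset.card_eq_sum_card_fiberwise (t := Finset.univ) (f := f) (s := E)
    fun _ _ => Finset.mem_coe.2 (Finset.mem_univ _)]
  refine le_trans ?_ (Finset.sum_le_sum_of_subset (Finset.filter_subset
    (fun x => d ≤ (E.filter (f · = x)).card) Finset.univ))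
  rw [← smul_eq_mul]
  exact Finset.card_nsmul_le_sum _ _ _ fun x hx => (Finset.mem_filter.1 hx).2

-- With `n` vertices, near pairs account for at most `n² / (4k)`, and saturated first or second ends
-- for at most `n² / (8k)` each.
omit [DecidableEq D] [Fintype D] in
theorem card_compl_freePairs_le {E : Finset (D × S × S)} {g d k : ℕ} (hd : 0 < d)
    (hout : ∀ x, (outEdges E x).card ≤ d) (hin : ∀ x, (inEdges E x).card ≤ d)
    (hg : 4 * k * (2 * d + 1) ^ g ≤ Fintype.card S)
    (hE : 8 * k * E.card ≤ d * Fintype.card S) :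
    2 * k * (freePairs E g d)ᶜ.card ≤ Fintype.card S ^ 2 := by
  set n := Fintype.card S with hn
  have hsat : ∀ f : D × S × S → S,
      8 * k * (Finset.univ.filter fun x => d ≤ (E.filter (f · = x)).card).card ≤ n := by
    intro f
    have := card_saturated_mul_le E d f
    refine Nat.le_of_mul_le_mul_left ?_ hd
    calc _ = 8 * k * ((Finset.univ.filter fun x => d ≤ (E.filter (f · = x)).card).card * d) := by
          ring
      _ ≤ 8 * k * E.card := Nat.mul_le_mul_left _ this
      _ ≤ _ := hE
  have h1 := hsat (·.2.1)
  have h2 := hsat (·.2.2)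
  set s1 := Finset.univ.filter fun x => d ≤ (E.filter (·.2.1 = x)).card
  set s2 := Finset.univ.filter fun x => d ≤ (E.filter (·.2.2 = x)).card
  have hsub : (freePairs E g d)ᶜ ⊆
      ((Finset.univ.sigma fun x => nearSet E g x).image fun p => (p.1, p.2)) ∪
        (s1 ×ˢ Finset.univ ∪ Finset.univ ×ˢ s2) := by
    rintro ⟨x, y⟩ hxy
    simp only [freePairs, Finset.mem_compl, Finset.mem_filter, Finset.mem_univ, true_and,
      not_and_or, not_not, not_lt] at hxy
    rcases hxy with h | h | h
    · exact Finset.mem_union_left _ (Finset.mem_image.2 ⟨⟨x, y⟩, by simpa using h, rfl⟩)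
    · exact Finset.mem_union_right _ (Finset.mem_union_left _ (by simpa [s1, outEdges] using h))
    · exact Finset.mem_union_right _ (Finset.mem_union_right _ (by simpa [s2, inEdges] using h))
  have hcard : (freePairs E g d)ᶜ.card ≤ n * (2 * d + 1) ^ g + (s1.card * n + n * s2.card) := by
    refine (Finset.card_le_card hsub).trans ((Finset.card_union_le _ _).trans
      (add_le_add (Finset.card_image_le.trans ?_) ((Finset.card_union_le _ _).trans ?_)))
    · rw [Finset.card_sigma]
      refine (Finset.sum_le_card_nsmul _ _ _ fun x _ => card_nearSet_le hout hin g x).trans ?_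
      simp [hn]
    · simp [hn]
  nlinarith [Nat.mul_le_mul_left n hg, Nat.mul_le_mul_left n h1, Nat.mul_le_mul_left n h2,
    Nat.mul_le_mul_left (2 * k) hcard]

/-- Each `φ` has at least `n² / k` monochromatic pairs, of which at least `n² / (2k)` are free.
Averaging over at most `k * n²` colored free pairs gives one that hits a fraction `1 / (2k²)` of
`P`. -/
theorem exists_freePair_hitting {E : Finset (D × S × S)} {g d : ℕ} [Nonempty S] (hd : 0 < d)
    (hout : ∀ x, (outEdges E x).card ≤ d) (hin : ∀ x, (inEdges E x).card ≤ d)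
    (hg : 4 * Fintype.card D * (2 * d + 1) ^ g ≤ Fintype.card S)
    (hE : 8 * Fintype.card D * E.card ≤ d * Fintype.card S) (P : Finset (S → D))
    (hP : P.Nonempty) :
    ∃ i, ∃ p ∈ freePairs E g d, P.card ≤
      2 * Fintype.card D ^ 2 * (P.filter fun φ => φ p.1 = i ∧ φ p.2 = i).card := by
  set n := Fintype.card S with hn
  set k := Fintype.card D with hk
  set Q := freePairs E g d with hQ
  have hn0 : 0 < n := Fintype.card_pos
  have hbad : 2 * k * Qᶜ.card ≤ n ^ 2 := card_compl_freePairs_le hd hout hin hg hE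
  have hmono : ∀ φ : S → D, n ^ 2 ≤ 2 * k * (Q.filter fun p => φ p.1 = φ p.2).card := by
    intro φ
    have h1 := sq_card_le_card_mul_card_monochromatic φ
    have h2 : (Finset.univ.filter fun p : S × S => φ p.1 = φ p.2).card ≤
        (Q.filter fun p => φ p.1 = φ p.2).card + Qᶜ.card := by
      refine (Finset.card_le_card ?_).trans (Finset.card_union_le _ _)
      intro p hp
      by_cases hpQ : p ∈ Q
      · exact Finset.mem_union_left _ (Finset.mem_filter.2 ⟨hpQ, (Finset.mem_filter.1 hp).2⟩)
      · exact Finset.mem_union_right _ (Finset.mem_compl.2 hpQ)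
    nlinarith [Nat.mul_le_mul_left (2 * k) h2]
  obtain ⟨φ₀, hφ₀⟩ := hP
  have hQne : Q.Nonempty := by
    rw [Finset.nonempty_iff_ne_empty]
    intro h0
    have := hmono φ₀
    rw [h0] at this
    simp at this
    omega
  have hD : Nonempty D := (inferInstance : Nonempty S).map φ₀
  have hsum : ∑ e ∈ (Finset.univ : Finset D) ×ˢ Q, P.card ≤ ∑ e ∈ (Finset.univ : Finset D) ×ˢ Q,
      2 * k ^ 2 * (P.filter fun φ => φ e.2.1 = e.1 ∧ φ e.2.2 = e.1).card := by
    rw [← Finset.mul_sum]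
    have hswap := Finset.sum_card_bipartiteAbove_eq_sum_card_bipartiteBelow
      (s := P) (t := (Finset.univ : Finset D) ×ˢ Q)
      (fun φ e => φ e.2.1 = e.1 ∧ φ e.2.2 = e.1)
    simp only [Finset.bipartiteAbove, Finset.bipartiteBelow] at hswap
    rw [← hswap]
    have hge : ∀ φ ∈ P, (Q.filter fun p => φ p.1 = φ p.2).card ≤
        (((Finset.univ : Finset D) ×ˢ Q).filter
          fun e => φ e.2.1 = e.1 ∧ φ e.2.2 = e.1).card := by
      intro φ _
      refine Finset.card_le_card_of_injOn (fun p => (φ p.1, p)) ?_ ?_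
      · intro p hp
        have hp' := Finset.mem_filter.1 (Finset.mem_coe.1 hp)
        simp [hp'.1, hp'.2]
      · intro p _ q _ h
        exact (Prod.ext_iff.1 h).2
    have hQcard : Q.card ≤ n ^ 2 := by
      refine (Finset.card_le_univ Q).trans ?_
      rw [Fintype.card_prod, sq]
    calc ∑ e ∈ (Finset.univ : Finset D) ×ˢ Q, P.card = k * Q.card * P.card := by
          simp [hk]
      _ ≤ k * n ^ 2 * P.card := by gcongr
      _ = k * ∑ φ ∈ P, n ^ 2 := by simp; ring
      _ ≤ k * ∑ φ ∈ P, 2 * k * (Q.filter fun p => φ p.1 = φ p.2).card := by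
          gcongr with φ _
          exact hmono φ
      _ = 2 * k ^ 2 * ∑ φ ∈ P, (Q.filter fun p => φ p.1 = φ p.2).card := by
          rw [← Finset.mul_sum]; ring
      _ ≤ _ := Nat.mul_le_mul_left _ (Finset.sum_le_sum hge)
  obtain ⟨⟨i, p⟩, he, hle⟩ := Finset.exists_le_of_sum_le
    (Finset.univ_nonempty.product hQne) hsum
  exact ⟨i, p, (Finset.mem_product.1 he).2, hle⟩

omit [Fintype D] [Fintype S] in
theorem card_filter_insert_le (E : Finset (D × S × S)) (f : D × S × S → S) (e : D × S × S)
    {d : ℕ} (h : ∀ x, (E.filter (f · = x)).card ≤ d) (he : (E.filter (f · = f e)).card < d)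
    (x : S) : ((insert e E).filter (f · = x)).card ≤ d := by
  rw [Finset.filter_insert]
  split_ifs with hx
  · subst hx
    exact (Finset.card_insert_le _ _).trans he
  · exact h x

/-- Each new edge removes a fraction of at least `1 / (2k²)` of the surviving maps. Once none
survive, edges are no longer added. -/
theorem exists_edges_card_unhit_le [Nonempty D] [Nonempty S] {g d m : ℕ} (hd : 0 < d)
    (hg : 4 * Fintype.card D * (2 * d + 1) ^ g ≤ Fintype.card S)
    (hm : 8 * Fintype.card D * m ≤ d * Fintype.card S) :
    ∃ E : Finset (D × S × S), E.card ≤ m ∧ (∀ x, (outEdges E x).card ≤ d) ∧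
      (∀ x, (inEdges E x).card ≤ d) ∧ HasGirthGT (edgeAdj E) g ∧
      ((unhit E).card : ℝ) ≤
        (1 - 1 / (2 * Fintype.card D ^ 2 : ℝ)) ^ m * (Fintype.card D) ^ (Fintype.card S) := by
  have hk : (1 : ℝ) ≤ Fintype.card D := by exact_mod_cast Fintype.card_pos (α := D)
  have hq : (0 : ℝ) ≤ 1 - 1 / (2 * Fintype.card D ^ 2 : ℝ) := by
    rw [sub_nonneg, div_le_one (by positivity)]
    nlinarith
  induction m with
  | zero =>
    refine ⟨∅, by simp, by simp [outEdges], by simp [inEdges], ?_, ?_⟩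
    · rintro (_ | ⟨i, w⟩) _ h _ x hx
      · exact h rfl
      · obtain ⟨y, hy, -⟩ := hx
        simp [edgeAdj] at hy
    · have := Finset.card_le_univ (unhit (∅ : Finset (D × S × S)))
      rw [Fintype.card_fun] at this
      simpa using (by exact_mod_cast this : ((unhit (∅ : Finset (D × S × S))).card : ℝ) ≤ _)
  | succ m ih =>
    obtain ⟨E, hEm, hout, hin, hgirth, hcard⟩ := ih (by nlinarith)
    rcases (unhit E).eq_empty_or_nonempty with h0 | hne
    · refine ⟨E, by omega, hout, hin, hgirth, ?_⟩
      rw [h0]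
      simp only [Finset.card_empty, Nat.cast_zero]
      positivity
    obtain ⟨i, ⟨x, y⟩, hp, hle⟩ := exists_freePair_hitting hd hout hin hg
      (by nlinarith : 8 * Fintype.card D * E.card ≤ d * Fintype.card S) _ hne
    simp only [freePairs, Finset.mem_filter, Finset.mem_univ, true_and] at hp hle
    obtain ⟨hnear, hx, hy⟩ := hp
    refine ⟨insert (i, x, y) E, (Finset.card_insert_le _ _).trans (by omega),
      card_filter_insert_le E (·.2.1) (i, x, y) hout hx,
      card_filter_insert_le E (·.2.2) (i, x, y) hin hy,
      hgirth.insert fun w hw h => hnear (mem_nearSet h hw), ?_⟩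
    have hsub : unhit (insert (i, x, y) E) ⊆
        unhit E \ (unhit E).filter fun φ => φ x = i ∧ φ y = i := by
      intro φ hφ
      simp only [unhit, Finset.mem_filter, Finset.mem_univ, true_and, Finset.mem_insert,
        forall_eq_or_imp, Finset.mem_sdiff] at hφ ⊢
      exact ⟨hφ.2, fun h => hφ.1 h.2⟩
    have h1 := Finset.card_le_card hsub
    have h2 := Finset.card_sdiff_add_card_eq_card
      (Finset.filter_subset (fun φ : S → D => φ x = i ∧ φ y = i) (unhit E))
    set a := ((unhit E).filter fun φ : S → D => φ x = i ∧ φ y = i).card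
    have h3 : ((unhit (insert (i, x, y) E)).card : ℝ) + a ≤ (unhit E).card := by
      exact_mod_cast (by omega : (unhit (insert (i, x, y) E)).card + a ≤ (unhit E).card)
    have h4 : ((unhit E).card : ℝ) / (2 * Fintype.card D ^ 2 : ℝ) ≤ a := by
      rw [div_le_iff₀ (by positivity), mul_comm]
      exact_mod_cast hle
    calc ((unhit (insert (i, x, y) E)).card : ℝ)
        ≤ (1 - 1 / (2 * Fintype.card D ^ 2 : ℝ)) * (unhit E).card := by
          rw [sub_mul, one_mul, one_div_mul_eq_div]
          linarith
      _ ≤ (1 - 1 / (2 * Fintype.card D ^ 2 : ℝ)) *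
          ((1 - 1 / (2 * Fintype.card D ^ 2 : ℝ)) ^ m *
            (Fintype.card D) ^ (Fintype.card S)) := by gcongr
      _ = _ := by ring

end Greedy

/-- For every `k` there are edge-`k`-colored graphs of logarithmic girth such that every vertex
coloring with `k` colors has an edge with the same color as both of its ends. -/
theorem exists_highGirth_edges (k : ℕ) : ∃ K : ℕ, 1 ≤ K ∧ ∀ n g : ℕ, 0 < n → K ^ (g + 1) ≤ n →
    ∃ E : Finset (Fin k × Fin n × Fin n), HasGirthGT (edgeAdj E) g ∧
      ∀ φ : Fin n → Fin k, ∃ i x y, edgeAdj E i x y ∧ φ x = i ∧ φ y = i := by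
  rcases Nat.eq_zero_or_pos k with rfl | hk
  · refine ⟨1, le_rfl, fun n g hn _ => ⟨∅, fun w _ hne _ => ?_, fun φ => (φ ⟨0, hn⟩).elim0⟩⟩
    rcases w with _ | ⟨i, w⟩
    · exact absurd rfl hne
    · exact i.elim0
  have hk1 : (1 : ℝ) ≤ k := by exact_mod_cast hk
  set q : ℝ := 1 - 1 / (2 * k ^ 2 : ℝ) with hq
  have hq0 : 0 ≤ q := by
    rw [hq, sub_nonneg, div_le_one (by positivity)]
    nlinarith
  have hq1 : q < 1 := by
    rw [hq, sub_lt_self_iff]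
    positivity
  -- There are `k ^ n` maps, so `C * n` edges leave at most `(q ^ C * k) ^ n < 1` of them.
  obtain ⟨C, hC⟩ := exists_pow_lt_of_lt_one (by positivity : (0 : ℝ) < 1 / k) hq1
  set d := 8 * k * C + 1 with hd
  refine ⟨4 * k * (2 * d + 1), Nat.one_le_iff_ne_zero.2 (by positivity), fun n g hn hng => ?_⟩
  have : NeZero k := ⟨hk.ne'⟩
  have : NeZero n := ⟨hn.ne'⟩
  obtain ⟨E, -, -, -, hgirth, hcard⟩ := exists_edges_card_unhit_le (D := Fin k) (S := Fin n)
    (g := g) (d := d) (m := C * n) (by omega) (by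
      rw [Fintype.card_fin, Fintype.card_fin]
      refine le_trans ?_ hng
      rw [mul_pow, pow_succ (2 * d + 1)]
      have h1 : 4 * k ≤ (4 * k) ^ (g + 1) := Nat.le_self_pow (by omega) _
      have h2 : 1 ≤ 2 * d + 1 := by omega
      calc 4 * k * (2 * d + 1) ^ g = 4 * k * ((2 * d + 1) ^ g * 1) := by ring
        _ ≤ _ := by gcongr) (by
      rw [Fintype.card_fin, Fintype.card_fin, hd]
      nlinarith)
  rw [Fintype.card_fin, Fintype.card_fin, pow_mul, ← mul_pow] at hcard
  have hlt : (q ^ C * k) ^ n < 1 := by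
    refine pow_lt_one₀ (by positivity) ?_ hn.ne'
    rwa [lt_div_iff₀ (by positivity)] at hC
  have h0 : (unhit E).card = 0 := by
    have : ((unhit E).card : ℝ) < 1 := hcard.trans_lt hlt
    exact_mod_cast Nat.lt_one_iff.1 (by exact_mod_cast this)
  refine ⟨E, hgirth, fun φ => ?_⟩
  have hφ : φ ∉ unhit E := by simp [Finset.card_eq_zero.1 h0]
  simp only [unhit, Finset.mem_filter, Finset.mem_univ, true_and, not_forall, not_not] at hφ
  obtain ⟨⟨i, x, y⟩, he, h⟩ := hφ
  exact ⟨i, x, y, .inl he, h⟩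

/-! ### Legal labelings embed balls of the tree as forests -/

section Embedding

variable {D S : Type*} {Adj : D → S → S → Prop} {f : List D → S}

theorem Legal.reach (hf : Legal Adj f) (p v : List D) (h : Reduced (p ++ v)) :
    Reach Adj v (f p) (f (p ++ v)) := by
  induction v generalizing p with
  | nil => simp [Reach]
  | cons i v ih =>
    have h' : Reduced (p ++ [i] ++ v) := by simpa using h
    exact ⟨f (p ++ [i]), hf p i h'.of_append_left, by simpa using ih _ h'⟩

/-- After the common prefix is removed, going back along one word and out along the other would be a
short reduced closed walk. -/
theorem Legal.eq_of_append (hsymm : ∀ i x y, Adj i x y → Adj i y x) {g : ℕ}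
    (hg : HasGirthGT Adj g) (hf : Legal Adj f) (u v p : List D) (hu : Reduced (p ++ u))
    (hv : Reduced (p ++ v)) (hlen : u.length + v.length ≤ g) (h : f (p ++ u) = f (p ++ v)) :
    u = v := by
  have hru := hf.reach p u hu
  have hrv := hf.reach p v hv
  have hu' : Reduced u := (List.isChain_append.1 hu).2.1
  have hv' : Reduced v := (List.isChain_append.1 hv).2.1
  induction u generalizing v p with
  | nil =>
    by_contra hne
    rw [← h, List.append_nil] at hrv
    exact hg v hv' (Ne.symm hne) (by simpa using hlen) _ hrv
  | cons a u ih =>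
    rcases v with _ | ⟨b, v⟩
    · rw [h, List.append_nil] at hru
      exact (hg _ hu' (by simp) (by simpa using hlen) _ hru).elim
    by_cases hab : a = b
    · subst hab
      have e : ∀ w, p ++ a :: w = p ++ [a] ++ w := by simp
      rw [e u] at hu
      rw [e v] at hv
      rw [e u, e v] at h
      simp only [List.length_cons] at hlen
      rw [ih v (p ++ [a]) hu hv (by omega) h (hf.reach _ _ hu) (hf.reach _ _ hv) hu'.tail hv'.tail]
    · have hcl := (hru.reverse hsymm).append hrv
      rw [h] at hcl
      refine (hg _ ?_ (by simp) (by simp at hlen ⊢; omega) _ hcl).elim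
      refine List.isChain_append.2 ⟨?_, hv', ?_⟩
      · rw [List.isChain_reverse]
        exact hu'.imp fun _ _ h => Ne.symm h
      · simpa using hab

/-- The labeling `f` is injective at distance at most `R` from the root. -/
def InjUpTo (R : ℕ) (f : List D → S) : Prop :=
  ∀ u v, Reduced u → Reduced v → u.length ≤ R → v.length ≤ R → f u = f v → u = v

theorem Legal.injUpTo (hsymm : ∀ i x y, Adj i x y → Adj i y x) {R : ℕ}
    (hg : HasGirthGT Adj (2 * R)) (hf : Legal Adj f) : InjUpTo R f :=
  fun u v hu hv hur hvr h => hf.eq_of_append hsymm hg u v [] hu hv (by omega) h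

/-- The image under `f` of the ball of radius `R` in the tree. -/
def wordGraph (R : ℕ) (f : List D → S) : SimpleGraph S where
  Adj a b := a ≠ b ∧ ∃ u v, Reduced u ∧ Reduced v ∧ u.length ≤ R ∧ v.length ≤ R ∧ TreeAdj u v ∧
    f u = a ∧ f v = b
  symm := ⟨fun _ _ ⟨hne, u, v, hu, hv, hur, hvr, h, ha, hb⟩ =>
    ⟨hne.symm, v, u, hv, hu, hvr, hur, h.symm, hb, ha⟩⟩
  loopless := ⟨fun _ h => h.1 rfl⟩

theorem TreeAdj.ne {u v : List D} (h : TreeAdj u v) : u ≠ v := by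
  obtain ⟨j, rfl | rfl⟩ := h <;> simp

theorem wordGraph_adj_iff {R : ℕ} (hf : InjUpTo R f) {u : List D} (hu : Reduced u)
    (hur : u.length ≤ R) {b : S} :
    (wordGraph R f).Adj (f u) b ↔ ∃ v, Reduced v ∧ v.length ≤ R ∧ TreeAdj u v ∧ f v = b := by
  constructor
  · rintro ⟨-, u', v, hu', hv, hur', hvr, h, ha, hb⟩
    obtain rfl := hf _ _ hu' hu hur' hur ha
    exact ⟨v, hv, hvr, h, hb⟩
  · rintro ⟨v, hv, hvr, h, rfl⟩
    exact ⟨fun e => h.ne (hf _ _ hu hv hur hvr e), u, v, hu, hv, hur, hvr, h, rfl, rfl⟩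

theorem wordGraph_congr {R : ℕ} {f g : List D → S} (h : AgreeUpTo R f g) :
    wordGraph R f = wordGraph R g := by
  ext a b
  constructor
  · rintro ⟨hne, u, v, hu, hv, hur, hvr, huv, ha, hb⟩
    exact ⟨hne, u, v, hu, hv, hur, hvr, huv, (h u hu hur) ▸ ha, (h v hv hvr) ▸ hb⟩
  · rintro ⟨hne, u, v, hu, hv, hur, hvr, huv, ha, hb⟩
    exact ⟨hne, u, v, hu, hv, hur, hvr, huv, (h u hu hur).symm ▸ ha, (h v hv hvr).symm ▸ hb⟩

/-- The descendants of `u ++ [j]` can be left only through the edge to `u`, which is deleted. -/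
theorem not_reachable_of_append_singleton {R : ℕ} (hf : InjUpTo R f) {u : List D} {j : D}
    (hv : Reduced (u ++ [j])) (hvr : (u ++ [j]).length ≤ R) :
    ¬ (wordGraph R f \ SimpleGraph.fromEdgeSet {s(f u, f (u ++ [j]))}).Reachable
      (f (u ++ [j])) (f u) := by
  have hu : Reduced u := hv.of_append_left
  have hur : u.length ≤ R := by simp at hvr; omega
  have key : ∀ x y, (wordGraph R f \ SimpleGraph.fromEdgeSet {s(f u, f (u ++ [j]))}).Walk x y →
      (∃ w, Reduced w ∧ w.length ≤ R ∧ u ++ [j] <+: w ∧ f w = x) →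
      ∃ w, Reduced w ∧ w.length ≤ R ∧ u ++ [j] <+: w ∧ f w = y := by
    intro x y p
    induction p with
    | nil => exact id
    | cons hadj _ ih =>
      rintro ⟨w, hw, hwr, hpre, rfl⟩
      apply ih
      rw [SimpleGraph.sdiff_adj, wordGraph_adj_iff hf hw hwr] at hadj
      obtain ⟨⟨w', hw', hwr', ⟨i, rfl | rfl⟩, rfl⟩, hne⟩ := hadj
      · exact ⟨_, hw', hwr', hpre.trans (List.prefix_append _ _), rfl⟩
      · rcases List.prefix_concat_iff.1 hpre with heq | hpre
        · obtain ⟨rfl, hij⟩ := List.append_inj' heq rfl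
          refine absurd ?_ hne
          rw [← heq, SimpleGraph.fromEdgeSet_adj]
          refine ⟨Sym2.eq_swap, fun e => ?_⟩
          simpa using hf _ _ hv hw' hvr hwr' e
        · exact ⟨_, hw', hwr', hpre, rfl⟩
  rintro ⟨p⟩
  obtain ⟨w, hw, hwr, hpre, h⟩ := key _ _ p ⟨_, hv, hvr, List.prefix_rfl, rfl⟩
  obtain rfl := hf _ _ hw hu hwr hur h
  simpa using hpre.length_le

theorem wordGraph_isAcyclic {R : ℕ} (hf : InjUpTo R f) : (wordGraph R f).IsAcyclic := by
  rw [SimpleGraph.isAcyclic_iff_forall_adj_isBridge]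
  rintro a b ⟨hne, u, v, hu, hv, hur, hvr, ⟨j, rfl | rfl⟩, rfl, rfl⟩
  · rw [SimpleGraph.isBridge_iff]
    exact fun h => not_reachable_of_append_singleton hf hv hvr h.symm
  · rw [Sym2.eq_swap, SimpleGraph.isBridge_iff]
    exact fun h => not_reachable_of_append_singleton hf hu hur h.symm

/-- Every neighbor of `u` is indexed by the color of the joining edge, which gives the degree bound.
-/
theorem TreeAdj.eq_of_getLast? [DecidableEq D] {u v : List D} (hv : Reduced v)
    (h : TreeAdj u v) : ∃ j, v = if u.getLast? = some j then u.dropLast else u ++ [j] := by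
  obtain ⟨j, rfl | rfl⟩ := h
  · refine ⟨j, (if_neg fun h => ?_).symm⟩
    exact (List.isChain_append.1 hv).2.2 j h j (by simp) rfl
  · exact ⟨j, by simp⟩

theorem ncard_neighborSet_wordGraph_le [Fintype D] {R : ℕ} (hf : InjUpTo R f) (x : S) :
    ((wordGraph R f).neighborSet x).ncard ≤ Fintype.card D := by
  classical
  by_cases hx : ∃ u, Reduced u ∧ u.length ≤ R ∧ f u = x
  · obtain ⟨u, hu, hur, rfl⟩ := hx
    have hsub : (wordGraph R f).neighborSet (f u) ⊆
        Set.range fun j => f (if u.getLast? = some j then u.dropLast else u ++ [j]) := by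
      intro b hb
      rw [SimpleGraph.mem_neighborSet, wordGraph_adj_iff hf hu hur] at hb
      obtain ⟨v, hv, -, h, rfl⟩ := hb
      obtain ⟨j, hj⟩ := h.eq_of_getLast? hv
      exact ⟨j, congrArg f hj.symm⟩
    refine (Set.ncard_le_ncard hsub (Set.finite_range _)).trans ?_
    rw [← Set.image_univ]
    refine (Set.ncard_image_le Set.finite_univ).trans ?_
    rw [Set.ncard_univ, Nat.card_eq_fintype_card]
  · have : (wordGraph R f).neighborSet x = ∅ := by
      rw [Set.eq_empty_iff_forall_notMem]
      rintro b ⟨-, u, -, hu, -, hur, -, -, ha, -⟩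
      exact hx ⟨u, hu, hur, ha⟩
    simp [this]

end Embedding

/-! ### Comparing the views of adjacent vertices -/

section Chart

variable {D : Type*} {V : Type}

/-- The ball of radius `r` around `g []` in `G` looks like the one in the tree, by means of `g`. -/
structure IsChart (G : SimpleGraph V) (r : ℕ) (g : List D → V) : Prop where
  adj_iff : ∀ u v, Reduced u → Reduced v → u.length ≤ r → v.length ≤ r →
    (G.Adj (g u) (g v) ↔ TreeAdj u v)
  exists_of_adj : ∀ u b, Reduced u → u.length < r → G.Adj (g u) b →
    ∃ v, Reduced v ∧ TreeAdj u v ∧ g v = b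

theorem IsChart.mem_ballSet_iff {G : SimpleGraph V} {r : ℕ} {g : List D → V}
    (hG : IsChart G r g) {x : V} :
    x ∈ ballSet G (g []) r ↔ ∃ u, Reduced u ∧ u.length ≤ r ∧ g u = x := by
  constructor
  · rintro ⟨p, hp⟩
    have key : ∀ a b (p : G.Walk a b) u, Reduced u → g u = a → u.length + p.length ≤ r →
        ∃ v, Reduced v ∧ v.length ≤ r ∧ g v = b := by
      intro a b p
      induction p with
      | nil => exact fun u hu h hr => ⟨u, hu, by simpa using hr, h⟩
      | cons hadj p ih =>
        rintro u hu rfl hr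
        rw [SimpleGraph.Walk.length_cons] at hr
        obtain ⟨v, hv, huv, hb⟩ := hG.exists_of_adj u _ hu (by omega) hadj
        have := huv.length_le
        exact ih v hv hb (by omega)
    exact key _ _ p [] (by simp) rfl (by simpa using hp)
  · rintro ⟨u, hu, hr, rfl⟩
    suffices h : ∃ p : G.Walk (g []) (g u), p.length ≤ u.length by
      obtain ⟨p, hp⟩ := h
      exact ⟨p, hp.trans hr⟩
    induction u using List.reverseRecOn with
    | nil => exact ⟨.nil, by simp⟩
    | append_singleton u j ih =>
      have hr' : u.length ≤ r := by simp at hr; omega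
      obtain ⟨p, hp⟩ := ih hu.of_append_left hr'
      refine ⟨p.concat ((hG.adj_iff _ _ hu.of_append_left hu hr' hr).2 ⟨j, .inl rfl⟩), ?_⟩
      simpa using hp

theorem IsChart.ball_isomorphic {G G' : SimpleGraph V} {r : ℕ} {g : List D → V}
    (hG : IsChart G r g) (hG' : IsChart G' r g) (ids : V → ℕ) :
    (ball G ids (g []) r).Isomorphic (ball G' ids (g []) r) := by
  have hset : ballSet G (g []) r = ballSet G' (g []) r := by
    ext x
    rw [hG.mem_ballSet_iff, hG'.mem_ballSet_iff]
  refine ⟨⟨Equiv.setCongr hset, ?_⟩, rfl, fun _ => rfl⟩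
  rintro ⟨x, hx⟩ ⟨y, hy⟩
  obtain ⟨u, hu, hur, rfl⟩ := hG.mem_ballSet_iff.1 hx
  obtain ⟨v, hv, hvr, rfl⟩ := hG.mem_ballSet_iff.1 hy
  exact (hG'.adj_iff u v hu hv hur hvr).trans (hG.adj_iff u v hu hv hur hvr).symm

theorem isChart_wordGraph {f : List D → V} {r R : ℕ} (hr : r ≤ R) (hf : InjUpTo R f) :
    IsChart (wordGraph R f) r f where
  adj_iff u v hu hv hur hvr := by
    rw [wordGraph_adj_iff hf hu (hur.trans hr)]
    constructor
    · rintro ⟨v', hv', hvr', h, e⟩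
      rwa [← hf _ _ hv' hv hvr' (hvr.trans hr) e]
    · exact fun h => ⟨v, hv, hvr.trans hr, h, rfl⟩
  exists_of_adj u b hu hur h := by
    rw [wordGraph_adj_iff hf hu (hur.le.trans hr)] at h
    obtain ⟨v, hv, -, h⟩ := h
    exact ⟨v, hv, h⟩

/-- The ball of radius `r` around the neighbor `[i]` lies in the ball of radius `r + 1` around the
root, so the forest built at the root shows the neighbor its full view. -/
theorem isChart_wordGraph_shift [DecidableEq D] {f : List D → V} {r : ℕ}
    (hf : InjUpTo (r + 1) f) (i : D) : IsChart (wordGraph (r + 1) f) r (shift i f) where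
  adj_iff u v hu hv hur hvr := by
    have hur' := length_leftMul_le i u
    have hvr' := length_leftMul_le i v
    rw [← treeAdj_leftMul_iff hu hv i]
    exact (isChart_wordGraph le_rfl hf).adj_iff _ _ (hu.leftMul i) (hv.leftMul i)
      (by omega) (by omega)
  exists_of_adj u b hu hur h := by
    have hur' := length_leftMul_le i u
    obtain ⟨v, hv, -, huv, rfl⟩ := (wordGraph_adj_iff hf (hu.leftMul i) (by omega)).1 h
    refine ⟨leftMul i v, hv.leftMul i, ?_, by rw [shift, leftMul_leftMul hv]⟩
    rw [← treeAdj_leftMul_iff hu (hv.leftMul i) i, leftMul_leftMul hv]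
    exact huv

end Chart

/-! ### From algorithms to colorings of the identifier graph -/

/-- Legal labelings exist only if every vertex has edges of all colors. A vertex without an edge of
color `i` inside `U` can safely receive `i`, so such vertices are peeled off. -/
theorem exists_coloring_of_forall_serial {D S : Type*} {Adj : D → S → S → Prop}
    (hsymm : ∀ i x y, Adj i x y → Adj i y x)
    (H : ∀ U : Finset S, (∀ i, ∀ x ∈ U, ∃ y ∈ U, Adj i x y) →
      ∃ φ : S → D, ∀ i, ∀ x ∈ U, ∀ y ∈ U, Adj i x y → φ x = i → φ y ≠ i) (U : Finset S) :
    ∃ φ : S → D, ∀ i, ∀ x ∈ U, ∀ y ∈ U, Adj i x y → φ x = i → φ y ≠ i := by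
  classical
  induction U using Finset.strongInduction with
  | H U ih =>
    by_cases hU : ∀ i, ∀ x ∈ U, ∃ y ∈ U, Adj i x y
    · exact H U hU
    push Not at hU
    obtain ⟨i, x, hx, hno⟩ := hU
    obtain ⟨φ, hφ⟩ := ih _ (Finset.erase_ssubset hx)
    refine ⟨Function.update φ x i, fun j y hy z hz hyz h1 h2 => ?_⟩
    by_cases hyx : y = x
    · subst hyx
      obtain rfl : i = j := by simpa using h1
      exact hno z hz hyz
    by_cases hzx : z = x
    · subst hzx
      obtain rfl : i = j := by simpa using h2
      exact hno y hy (hsymm _ _ _ hyz)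
    rw [Function.update_of_ne hyx] at h1
    rw [Function.update_of_ne hzx] at h2
    exact hφ j y (Finset.mem_erase.2 ⟨hyx, hy⟩) z (Finset.mem_erase.2 ⟨hzx, hz⟩) hyz h1 h2

/-- A local algorithm that colors forests yields a coloring of every edge-colored graph of large
girth such that no edge has its color at both ends. -/
theorem exists_coloring_of_algorithm {Δ n r : ℕ} (hn : 0 < n) (run : RootedLabeledGraph → ℕ)
    (hrun : ∀ B B' : RootedLabeledGraph, B.Isomorphic B' → run B = run B')
    (hcol : ∀ G : SimpleGraph (Fin n), acyclicOfDegreeLE Δ (Fin n) G →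
      IsVertexColoring G Δ fun v => run (ball G Fin.val v r))
    {Adj : Fin Δ → Fin n → Fin n → Prop} (hsymm : ∀ i x y, Adj i x y → Adj i y x)
    (hg : HasGirthGT Adj (2 * (r + 1))) :
    ∃ φ : Fin n → Fin Δ, ∀ i x y, Adj i x y → φ x = i → φ y ≠ i := by
  -- The edgeless graph on `n > 0` vertices already needs a color.
  have hΔ : NeZero Δ := by
    have := (hcol ⊥ ⟨SimpleGraph.isAcyclic_bot, fun v => by simp⟩).1 ⟨0, hn⟩
    exact ⟨by omega⟩
  suffices H : ∀ U : Finset (Fin n), (∀ i, ∀ x ∈ U, ∃ y ∈ U, Adj i x y) →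
      ∃ φ : Fin n → Fin Δ, ∀ i, ∀ x ∈ U, ∀ y ∈ U, Adj i x y → φ x = i → φ y ≠ i by
    obtain ⟨φ, hφ⟩ := exists_coloring_of_forall_serial hsymm H Finset.univ
    exact ⟨φ, fun i x y => hφ i x (Finset.mem_univ _) y (Finset.mem_univ _)⟩
  intro U hU
  let AdjU : Fin Δ → U → U → Prop := fun i x y => Adj i x y
  let out : (List (Fin Δ) → U) → ℕ := fun f =>
    run (ball (wordGraph (r + 1) fun w => (f w : Fin n)) Fin.val (f []) r)
  have hinj : ∀ f : List (Fin Δ) → U, Legal AdjU f → InjUpTo (r + 1) fun w => (f w : Fin n) :=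
    fun f hf => Legal.injUpTo (Adj := Adj) hsymm hg fun w j h => hf w j h
  have hcolf : ∀ f : List (Fin Δ) → U, Legal AdjU f →
      IsVertexColoring (wordGraph (r + 1) fun w => (f w : Fin n)) Δ
        fun v => run (ball (wordGraph (r + 1) fun w => (f w : Fin n)) Fin.val v r) :=
    fun f hf => hcol _ ⟨wordGraph_isAcyclic (hinj f hf), fun v => by
      simpa using ncard_neighborSet_wordGraph_le (hinj f hf) v⟩
  have hsymmU : ∀ i x y, AdjU i x y → AdjU i y x := fun i x y => hsymm i x y
  -- The algorithm looks only at radius `r`, but radius `r + 1` is immediate because it determines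
  -- the whole forest.
  have hloc : IsLocal AdjU (r + 1) fun f => Fin.ofNat Δ (out f - 1) := by
    intro f g hf hg' hfg
    have h1 : (wordGraph (r + 1) fun w => (f w : Fin n)) =
        wordGraph (r + 1) fun w => (g w : Fin n) :=
      wordGraph_congr fun w hw hr => by rw [hfg w hw hr]
    have h2 : f [] = g [] := hfg [] (by simp) (by simp)
    simp only [out, h1, h2]
  have hsink : IsSinkless AdjU fun f => Fin.ofNat Δ (out f - 1) := by
    intro f hf i h1 h2
    have hf' := hf.shift hsymmU i
    have hc := hcolf f hf
    have hb1 : 1 ≤ out f ∧ out f ≤ Δ := hc.1 _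
    have hb2 : 1 ≤ out (shift i f) ∧ out (shift i f) ≤ Δ := (hcolf _ hf').1 _
    -- Outputs lie in `1, …, Δ`, where subtracting `1` and reducing modulo `Δ` is injective.
    have heq : out f = out (shift i f) := by
      have h3 := congrArg Fin.val (h1.trans h2.symm)
      simp only [Fin.val_ofNat] at h3
      rw [Nat.mod_eq_of_lt (by omega), Nat.mod_eq_of_lt (by omega)] at h3
      omega
    have hball : out (shift i f) =
        run (ball (wordGraph (r + 1) fun w => (f w : Fin n)) Fin.val (f [i]) r) :=
      hrun _ _ (IsChart.ball_isomorphic (g := fun w => ((shift i f w : U) : Fin n))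
        (isChart_wordGraph (Nat.le_succ r) (hinj _ hf'))
        (isChart_wordGraph_shift (hinj f hf) i) _)
    refine hc.2 (f []) (f [i]) ?_ (heq.trans hball)
    exact (wordGraph_adj_iff (hinj f hf) (u := []) (by simp) (by simp)).2
      ⟨[i], by simp, by simp, ⟨i, .inl rfl⟩, rfl⟩
  have hserial : ∀ i x, ∃ y, AdjU i x y := fun i x => by
    obtain ⟨y, hy, h⟩ := hU i x x.2
    exact ⟨⟨y, hy⟩, h⟩
  obtain ⟨φ, hφ⟩ := exists_coloring_of_isLocal hsymmU hserial (r + 1) _ hloc hsink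
  classical
  refine ⟨fun x => if hx : x ∈ U then φ ⟨x, hx⟩ else 0, fun i x hx y hy hxy => ?_⟩
  simp only [hx, hy, dif_pos]
  exact hφ i ⟨x, hx⟩ ⟨y, hy⟩ hxy

theorem eventually_pow_le {t : ℕ → ℝ} (ht : t =o[atTop] fun n : ℕ => Real.log n) {K : ℕ}
    (hK : 1 ≤ K) : ∀ᶠ n : ℕ in atTop, K ^ (2 * (⌊t n⌋₊ + 1) + 1) ≤ n := by
  have hL : 0 ≤ Real.log K := Real.log_natCast_nonneg K
  set L := Real.log K with hLdef
  -- With `r = ⌊t n⌋₊` the exponent is `2r + 3`. The two bounds give `2rL ≤ log n / 2` and `3L ≤ log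
  -- n / 2`.
  filter_upwards [ht.def (by positivity : (0 : ℝ) < 1 / (4 * (L + 1))),
    (Real.tendsto_log_atTop.comp tendsto_natCast_atTop_atTop).eventually_ge_atTop (6 * L),
    eventually_gt_atTop 0] with n h1 h2 hn
  simp only [Function.comp_apply] at h2
  have hlog : 0 ≤ Real.log n := Real.log_natCast_nonneg n
  rw [Real.norm_eq_abs, Real.norm_eq_abs, abs_of_nonneg hlog] at h1
  have hr : (⌊t n⌋₊ : ℝ) ≤ |t n| :=
    (Nat.cast_le.2 (Nat.floor_le_floor (le_abs_self _))).trans (Nat.floor_le (abs_nonneg _))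
  have h3 : (⌊t n⌋₊ : ℝ) * (4 * (L + 1)) ≤ Real.log n := by
    rw [one_div, inv_mul_eq_div] at h1
    exact (le_div_iff₀ (by positivity)).1 (hr.trans h1)
  have h4 : (0 : ℝ) ≤ ⌊t n⌋₊ := Nat.cast_nonneg _
  have hK' : (0 : ℝ) < K := by exact_mod_cast hK
  have hn' : (0 : ℝ) < n := by exact_mod_cast hn
  have h5 : ((K : ℝ) ^ (2 * (⌊t n⌋₊ + 1) + 1)) ≤ n := by
    rw [← Real.log_le_log_iff (by positivity) hn', Real.log_pow, ← hLdef]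
    push_cast
    nlinarith
  exact_mod_cast h5

end LocalModel

theorem theoremt (Δ : ℕ) (c : ℝ) (hc : 1 ≤ c) :
    ¬ ∃ t : ℕ → ℝ, t =o[atTop] (fun n : ℕ => Real.log n) ∧
      LocalModel.HasDetColoringAlgorithm (LocalModel.acyclicOfDegreeLE Δ) c Δ t := by
  rintro ⟨t, ht, 𝒜, h𝒜⟩
  obtain ⟨K, hK, hgirth⟩ := LocalModel.exists_highGirth_edges Δ
  obtain ⟨n, hKn, hn⟩ :=
    ((LocalModel.eventually_pow_le ht hK).and (eventually_gt_atTop 0)).exists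
  obtain ⟨E, hE, hhit⟩ := hgirth n _ hn hKn
  obtain ⟨φ, hφ⟩ := LocalModel.exists_coloring_of_algorithm
    (Adj := LocalModel.edgeAdj E) (r := ⌊t n⌋₊) hn (𝒜.run n)
    (𝒜.run_eq_of_isomorphic n) (fun G hG => by
      -- The identifiers `0, …, n - 1` are admissible since `n ≤ n ^ c`.
      have hids : LocalModel.IsIdAssignment c (Fin.val : Fin n → ℕ) := by
        refine ⟨Fin.val_injective, fun v => ?_⟩
        rw [Fintype.card_fin]
        have h1 : (1 : ℝ) ≤ n := by exact_mod_cast hn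
        calc ((v : ℕ) : ℝ) < n := by exact_mod_cast v.2
          _ = (n : ℝ) ^ (1 : ℝ) := (Real.rpow_one _).symm
          _ ≤ (n : ℝ) ^ c := Real.rpow_le_rpow_of_exponent_le h1 hc
      have hout : 𝒜.output t G Fin.val =
          fun v => 𝒜.run n (LocalModel.ball G Fin.val v ⌊t n⌋₊) := by
        funext v
        rw [LocalModel.DetAlgorithm.output, Fintype.card_fin]
      exact hout ▸ h𝒜 (Fin n) G hG Fin.val hids)
    (fun _ _ _ h => LocalModel.edgeAdj.symm h) hE
  obtain ⟨i, x, y, hxy, hx, hy⟩ := hhit φ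
  exact hφ i x y hxy hx hy
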